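/- Let $k\ge 1$ be an integer, $\mathcal X=\{1,\dots,2k\}$, $\mathcal Y=\mathcal X\cup\{\bot\}$ and $\eta=1/\sqrt k$. For $x^\ast\in\mathcal X$ let $W_{x^\ast}$ be the channel from $\mathcal X$ to $\mathcal Y$ that sends the symbol $x^\ast$ to itself and, for $x\ne x^\ast$, outputs $x$ with probability $\eta$ and $\bot$ with probability $1-\eta$; put $\mathcal W_\bot^{\eta}=\{W_{x^\ast}: x^\ast\in\mathcal X\}$. There are $n$ users holding i.i.d. samples $X_1,\dots,X_n$ from an unknown distribution $\mathbf p$ on $\mathcal X$; user $t$ passes $X_t$ through a channel $W_t\in\mathcal W_\bot^{\eta}$ and sends the output $Y_t$ to a server. In a public-coin (noninteractive) protocol, a random variable $U$ independent of the samples is known to all users and to the server, and each $W_t$ is a function of $U$; the server outputs a randomized decision $T(Y^n,U)\in\{0,1\}$. In a private-coin (noninteractive) protocol, there are independent random variables $U_1,\dots,U_n$, jointly independent of the samples, $U_t$ is known only to user $t$, and $W_t$ is a function of $U_t$; the server outputs a randomized decision $T(Y^n)\in\{0,1\}$. A protocol with a decision is an $(n,\varepsilon)$-test for uniformity if $\Pr[T=0]\ge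 99/100$ when $\mathbf p$ is the uniform distribution $\mathbf u$ on $\mathcal X$, and $\Pr[T=1]\ge 99/100$ for every $\mathbf p$ with $\mathrm d_{\mathrm{TV}}(\mathbf p,\mathbf u)=\sup_{S\subseteq\mathcal X}(\mathbf p(S)-\mathbf u(S))\ge\varepsilon$. The public-coin (private-coin) sample complexity of $(2k,\varepsilon)$-uniformity testing under $\mathcal W_\bot^{\eta}$ is the least $n$ for which there is a public-coin (private-coin) $(n,\varepsilon)$-test. Then, for both public-coin and private-coin protocols, the sample complexity of noninteractive $(2k,\varepsilon)$-uniformity testing under $\mathcal W_\bot^{1/\sqrt k}$ is $\Theta(k/\varepsilon^2)$. Precisely, there are absolute constants $c,C>0$ such that for all $k\ge1$ both sample complexities exist (that is, are finite) and are at most $C\,k/\varepsilon^2$ for every $\varepsilon\in(0,1]$, and both are at least $c\,k/\varepsilon^2$ for every $\varepsilon\in(0,1/2]$. -/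

import Mathlib

open MeasureTheory

noncomputable section

namespace DistributedTesting

/-- A channel from `X` to the finite message space `Y`: a randomized function, `W x y` being the
probability `W(y | x)` of the output `y` on the input `x`. -/
abbrev Channel (X Y : Type) [Fintype Y] : Type := X → stdSimplex ℝ Y

/-- Total variation distance `sup_S (p₁(S) - p₂(S))`. -/
def tvDist {X : Type} [Fintype X] (p₁ p₂ : stdSimplex ℝ X) : ℝ :=
  ⨆ S : Finset X, (∑ x ∈ S, p₁ x - ∑ x ∈ S, p₂ x)

/-- The distribution of the output of the channel `W` when its input has distribution `p`. -/
def outputProb {X Y : Type} [Fintype X] [Fintype Y] (W : Channel X Y) (p : stdSimplex ℝ X)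
    (y : Y) : ℝ :=
  ∑ x, p x * W x y

/-- The distribution of the messages `Y₁, …, Yₙ` of `n` users that use the fixed channels
`W₁, …, Wₙ` on i.i.d. samples from `p`: the messages are independent. -/
def messagesProb {X Y : Type} [Fintype X] [Fintype Y] {n : ℕ} (W : Fin n → Channel X Y)
    (p : stdSimplex ℝ X) (y : Fin n → Y) : ℝ :=
  ∏ t, outputProb (W t) p (y t)

variable {X Y : Type} [Fintype X] [Fintype Y]

/-- A public-coin noninteractive protocol for `n` users under the constraints `𝒲`: a random
variable `U` (with values in the probability space `(Coin, law)`), independent of the samples, is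
seen by all the users and by the server, and each user selects a channel in `𝒲` as a function
of `U`. -/
structure PublicCoinProtocol (𝒲 : Set (Channel X Y)) (n : ℕ) where
  Coin : Type
  [measurableSpace : MeasurableSpace Coin]
  law : Measure Coin
  [isProbabilityMeasure : IsProbabilityMeasure law]
  chan : Fin n → Coin → Channel X Y
  chan_mem : ∀ t u, chan t u ∈ 𝒲
  measurable_chan : ∀ t x y, Measurable fun u => chan t u x y

attribute [instance] PublicCoinProtocol.measurableSpace PublicCoinProtocol.isProbabilityMeasure

/-- A private-coin noninteractive protocol for `n` users under the constraints `𝒲`: the user `t`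
alone sees a random variable `U_t` (with values in `(Coin t, law t)`) and selects a channel in `𝒲`
as a function of `U_t`; `U₁, …, Uₙ` are independent, and jointly independent of the samples. -/
structure PrivateCoinProtocol (𝒲 : Set (Channel X Y)) (n : ℕ) where
  Coin : Fin n → Type
  [measurableSpace : ∀ t, MeasurableSpace (Coin t)]
  law : ∀ t, Measure (Coin t)
  [isProbabilityMeasure : ∀ t, IsProbabilityMeasure (law t)]
  chan : ∀ t, Coin t → Channel X Y
  chan_mem : ∀ t u, chan t u ∈ 𝒲
  measurable_chan : ∀ t x y, Measurable fun u => chan t u x y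

attribute [instance] PrivateCoinProtocol.measurableSpace PrivateCoinProtocol.isProbabilityMeasure

/-- A private-coin protocol as a special public-coin protocol, with `U = (U₁, …, Uₙ)`. -/
def PrivateCoinProtocol.toPublic {𝒲 : Set (Channel X Y)} {n : ℕ}
    (Q : PrivateCoinProtocol 𝒲 n) : PublicCoinProtocol 𝒲 n where
  Coin := ∀ t, Q.Coin t
  law := Measure.pi Q.law
  chan t u := Q.chan t (u t)
  chan_mem t u := Q.chan_mem t (u t)
  measurable_chan t x y := (Q.measurable_chan t x y).comp (measurable_pi_apply t)

/-- A randomized decision function `T : Yⁿ × U → {0, 1}` of the server: `dec y u b` is the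
probability that it outputs `b` on the messages `y` and the coins `u`. -/
structure Decision {𝒲 : Set (Channel X Y)} {n : ℕ} (P : PublicCoinProtocol 𝒲 n) where
  dec : (Fin n → Y) → P.Coin → stdSimplex ℝ (Fin 2)
  measurable_dec : ∀ y b, Measurable fun u => dec y u b

/-- A randomized decision function `T : Yⁿ → {0, 1}` that does not see the users' private coins. -/
def Decision.ofMessages {𝒲 : Set (Channel X Y)} {n : ℕ} (P : PublicCoinProtocol 𝒲 n)
    (T : (Fin n → Y) → stdSimplex ℝ (Fin 2)) : Decision P where
  dec y _ := T y
  measurable_dec _ _ := measurable_const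

/-- The probability that the decision is `b` when the samples are i.i.d. from `p`. -/
def decisionProb {𝒲 : Set (Channel X Y)} {n : ℕ} (P : PublicCoinProtocol 𝒲 n) (T : Decision P)
    (p : stdSimplex ℝ X) (b : Fin 2) : ℝ :=
  ∫ u, ∑ y, messagesProb (fun t => P.chan t u) p y * T.dec y u b ∂P.law

/-- The pair `(P, T)` tests `p = q` (decision `0`) against `d_TV(p, q) ≥ ε` (decision `1`). -/
def IsTest {𝒲 : Set (Channel X Y)} {n : ℕ} (q : stdSimplex ℝ X) (ε : ℝ)
    (P : PublicCoinProtocol 𝒲 n) (T : Decision P) : Prop :=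
  99 / 100 ≤ decisionProb P T q 0 ∧
    ∀ p : stdSimplex ℝ X, ε ≤ tvDist p q → 99 / 100 ≤ decisionProb P T p 1

/-- The set of `n` for which there is a public-coin `(n, ε)`-test for uniformity using `𝒲`. -/
def publicCoinTestSizes [Nonempty X] (𝒲 : Set (Channel X Y)) (ε : ℝ) : Set ℕ :=
  {n | ∃ (P : PublicCoinProtocol 𝒲 n) (T : Decision P), IsTest stdSimplex.barycenter ε P T}

/-- The set of `n` for which there is a private-coin `(n, ε)`-test for uniformity using `𝒲`. -/
def privateCoinTestSizes [Nonempty X] (𝒲 : Set (Channel X Y)) (ε : ℝ) : Set ℕ :=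
  {n | ∃ (Q : PrivateCoinProtocol 𝒲 n) (T : (Fin n → Y) → stdSimplex ℝ (Fin 2)),
    IsTest stdSimplex.barycenter ε Q.toPublic (Decision.ofMessages Q.toPublic T)}

/-- `n` is the sample complexity of public-coin uniformity testing using `𝒲`. -/
def IsPublicCoinSampleComplexity [Nonempty X] (𝒲 : Set (Channel X Y)) (ε : ℝ) (n : ℕ) : Prop :=
  IsLeast (publicCoinTestSizes 𝒲 ε) n

/-- `n` is the sample complexity of private-coin uniformity testing using `𝒲`. -/
def IsPrivateCoinSampleComplexity [Nonempty X] (𝒲 : Set (Channel X Y)) (ε : ℝ) (n : ℕ) : Prop :=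
  IsLeast (privateCoinTestSizes 𝒲 ε) n

/-- The channel `W_{x₀}` from `X` to `X ∪ {⊥}` (`⊥` is `none`), which sends `x₀` exactly and
erases every other symbol with probability `1 - η`. -/
def partialErasure {X : Type} [Fintype X] [DecidableEq X] (η : unitInterval) (x₀ : X) :
    Channel X (Option X) := fun x =>
  ⟨fun y => match y with
    | some z => if z = x then (if x = x₀ then 1 else (η : ℝ)) else 0
    | none => if x = x₀ then 0 else 1 - (η : ℝ), by
    refine ⟨fun y => ?_, ?_⟩
    · have h0 := η.2.1
      have h1 := η.2.2
      rcases y with _ | z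
      · dsimp only
        split_ifs <;> linarith
      · dsimp only
        split_ifs <;> linarith
    · rw [Fintype.sum_option, Finset.sum_ite_eq' Finset.univ x]
      split_ifs <;> simp_all⟩

/-- The family of partial erasure channels with parameter `η`. -/
def partialErasureFamily (X : Type) [Fintype X] [DecidableEq X] (η : unitInterval) :
    Set (Channel X (Option X)) :=
  Set.range (partialErasure η)

/-- The parameter `η = 1 / √k`. -/
def invSqrt (k : ℕ) : unitInterval :=
  ⟨1 / √(k : ℝ), by positivity, by
    rcases Nat.eq_zero_or_pos k with rfl | hk
    · simp
    · have h : (1 : ℝ) ≤ √(k : ℝ) := Real.one_le_sqrt.mpr (by exact_mod_cast hk)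
      exact (div_le_one (by linarith)).mpr h⟩

end DistributedTesting

end

open DistributedTesting

/-! Upper bound. No coins are needed: `2m` users share one channel `W_{x₀}`. A message is turned
into a centred indicator vector, scaled by `η` at `x₀`, whose mean is exactly `η(p - u)`. The inner
product of the score sums of the two halves then has mean `(mη)²‖p - u‖₂²`, and its variance is
bounded as if every sample were erased with probability `1 - η` whatever its value
(`variance_erasureScore_le`). Thus `mη` acts as an effective sample size. Collision-type testing
needs about `√k/ε²` effective samples, that is `m ≈ k/ε²`, and Chebyshev's inequality finishes
(`add_self_mem_privateCoinTestSizes`).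

Lower bound. The symbols are paired and the uniform law is perturbed by `1 ± 2ε` with opposite signs
inside each pair, giving alternatives indexed by sign vectors `z`. Conditionally on the coins, the
channels are fixed and the second moment of the average likelihood ratio is at most `exp(∑ᵢ cᵢ²/2)`,
where `cᵢ` is of order `(ε²/k)(nη + Nᵢ)` at most and `Nᵢ` counts the users whose exact symbol lies
in pair `i` (`sum_messagesProb_mul_likelihood_le`). Since `kη² = 1` and `∑ Nᵢ² ≤ n²`, the exponent
is `O((nε²/k)²)` however the symbols are chosen (`sum_sq_sum_le`). A bounded second moment limits
the average power of any test (`sum_decisionProb_le`); the bound holds for each value of the coins,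
so public coins do not help. A private-coin test is a public-coin test, so the two bounds settle
both models. -/

noncomputable section

namespace DistributedTesting

/-! ### Moments of the cross statistic of two independent i.i.d. samples. -/

section ProductWeights

variable {Y ι : Type}

/-- The weight of the sequence `a` when its entries are independent with weights `r`. -/
def prodWeight (r : Y → ℝ) {m : ℕ} (a : Fin m → Y) : ℝ := ∏ t, r (a t)

/-- The sum of the products of the `z`-th coordinates, over all pairs of an entry of `a` and an
entry of `b`. -/
def crossStatistic [Fintype ι] (φ : Y → ι → ℝ) {m : ℕ} (a b : Fin m → Y) : ℝ :=
  ∑ z, (∑ s, φ (a s) z) * ∑ t, φ (b t) z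

lemma prodWeight_nonneg {r : Y → ℝ} (hr : ∀ y, 0 ≤ r y) {m : ℕ} (a : Fin m → Y) :
    0 ≤ prodWeight r a :=
  Finset.prod_nonneg fun t _ => hr (a t)

lemma prodWeight_cons (r : Y → ℝ) {m : ℕ} (y : Y) (a : Fin m → Y) :
    prodWeight r (Fin.cons y a : Fin (m + 1) → Y) = r y * prodWeight r a := by
  simp [prodWeight, Fin.prod_univ_succ]

variable [Fintype Y] [Fintype ι]

lemma sum_fin_succ_pi {m : ℕ} (F : (Fin (m + 1) → Y) → ℝ) :
    ∑ a, F a = ∑ y, ∑ a : Fin m → Y, F (Fin.cons y a) := by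
  rw [← (Fin.consEquiv fun _ : Fin (m + 1) => Y).sum_comp F, Fintype.sum_prod_type]
  rfl

lemma sum_prodWeight {r : Y → ℝ} (hr1 : ∑ y, r y = 1) (m : ℕ) :
    ∑ a : Fin m → Y, prodWeight r a = 1 := by
  induction m with
  | zero => simp [prodWeight]
  | succ m ih =>
    rw [sum_fin_succ_pi]
    simp only [prodWeight_cons, ← Finset.mul_sum, ih, mul_one, hr1]

lemma sum_prodWeight_mul_sum {r : Y → ℝ} (hr1 : ∑ y, r y = 1) (m : ℕ)
    (f : Y → ℝ) :
    ∑ a : Fin m → Y, prodWeight r a * ∑ t, f (a t) = m * ∑ y, r y * f y := by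
  induction m with
  | zero => simp
  | succ m ih =>
    rw [sum_fin_succ_pi]
    have h : ∀ y, ∑ a : Fin m → Y, prodWeight r (Fin.cons y a : Fin (m + 1) → Y) *
        ∑ t, f ((Fin.cons y a : Fin (m + 1) → Y) t) =
        r y * f y + r y * (m * ∑ y, r y * f y) := by
      intro y
      rw [← ih, ← mul_one (r y * f y), ← sum_prodWeight hr1 m, Finset.mul_sum, Finset.mul_sum,
        ← Finset.sum_add_distrib]
      refine Finset.sum_congr rfl fun a _ => ?_
      simp only [prodWeight_cons, Fin.sum_univ_succ, Fin.cons_zero, Fin.cons_succ]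
      ring
    simp only [h, Finset.sum_add_distrib, ← Finset.sum_mul, hr1]
    push_cast
    ring

/-- The `m` diagonal pairs of positions give the joint moment; the `m(m - 1)` ordered off-diagonal
pairs factor by independence. -/
lemma sum_prodWeight_mul_sum_mul_sum {r : Y → ℝ} (hr1 : ∑ y, r y = 1) (m : ℕ)
    (f g : Y → ℝ) :
    ∑ a : Fin m → Y, prodWeight r a * ((∑ t, f (a t)) * ∑ t, g (a t)) =
      m * ∑ y, r y * (f y * g y) + m * (m - 1) * ((∑ y, r y * f y) * ∑ y, r y * g y) := by
  induction m with
  | zero => simp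
  | succ m ih =>
    rw [sum_fin_succ_pi]
    have h : ∀ y, ∑ a : Fin m → Y, prodWeight r (Fin.cons y a : Fin (m + 1) → Y) *
        ((∑ t, f ((Fin.cons y a : Fin (m + 1) → Y) t)) *
          ∑ t, g ((Fin.cons y a : Fin (m + 1) → Y) t)) =
        r y * (f y * g y) + (r y * f y * (m * ∑ y, r y * g y) +
          r y * g y * (m * ∑ y, r y * f y)) + r y * (m * ∑ y, r y * (f y * g y) +
            m * (m - 1) * ((∑ y, r y * f y) * ∑ y, r y * g y)) := by
      intro y
      rw [← ih, ← mul_one (r y * (f y * g y)), ← sum_prodWeight hr1 m,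
        ← sum_prodWeight_mul_sum hr1, ← sum_prodWeight_mul_sum hr1]
      simp only [Finset.mul_sum _ (fun a => prodWeight r a), Finset.mul_sum _ (fun a : Fin m → Y =>
        prodWeight r a * _), ← Finset.sum_add_distrib]
      refine Finset.sum_congr rfl fun a _ => ?_
      simp only [prodWeight_cons, Fin.sum_univ_succ, Fin.cons_zero, Fin.cons_succ]
      ring
    simp only [h, Finset.sum_add_distrib, ← Finset.sum_mul, hr1]
    push_cast
    ring

/-- Pairing two independent halves removes diagonal terms, so the statistic is unbiased for the
squared norm of the mean. -/
lemma expectation_crossStatistic {r : Y → ℝ} (hr1 : ∑ y, r y = 1) (m : ℕ)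
    (φ : Y → ι → ℝ) :
    ∑ a : Fin m → Y, ∑ b : Fin m → Y, prodWeight r a * prodWeight r b * crossStatistic φ a b =
      (m : ℝ) ^ 2 * ∑ z, (∑ y, r y * φ y z) ^ 2 := by
  have h : ∀ a b : Fin m → Y, prodWeight r a * prodWeight r b * crossStatistic φ a b =
      ∑ z, (prodWeight r a * ∑ s, φ (a s) z) * (prodWeight r b * ∑ s, φ (b s) z) := by
    intro a b
    rw [crossStatistic, Finset.mul_sum]
    exact Finset.sum_congr rfl fun z _ => by ring
  simp only [h]
  simp_rw [Finset.sum_comm (t := (Finset.univ : Finset ι))]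
  rw [Finset.mul_sum]
  refine Finset.sum_congr rfl fun z _ => ?_
  rw [← Finset.sum_mul_sum, sum_prodWeight_mul_sum hr1 m fun y => φ y z]
  ring

lemma expectation_crossStatistic_sq {r : Y → ℝ} (hr1 : ∑ y, r y = 1) (m : ℕ)
    (φ : Y → ι → ℝ) :
    ∑ a : Fin m → Y, ∑ b : Fin m → Y, prodWeight r a * prodWeight r b *
      crossStatistic φ a b ^ 2 =
      ∑ z, ∑ z', (m * ∑ y, r y * (φ y z * φ y z') +
        m * (m - 1) * ((∑ y, r y * φ y z) * ∑ y, r y * φ y z')) ^ 2 := by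
  have h : ∀ a b : Fin m → Y, prodWeight r a * prodWeight r b * crossStatistic φ a b ^ 2 =
      ∑ z, ∑ z', (prodWeight r a * ((∑ s, φ (a s) z) * ∑ s, φ (a s) z')) *
        (prodWeight r b * ((∑ s, φ (b s) z) * ∑ s, φ (b s) z')) := by
    intro a b
    rw [crossStatistic, sq, Finset.sum_mul_sum, Finset.mul_sum]
    refine Finset.sum_congr rfl fun z _ => ?_
    rw [Finset.mul_sum]
    exact Finset.sum_congr rfl fun z' _ => by ring
  simp only [h]
  simp_rw [Finset.sum_comm (s := (Finset.univ : Finset (Fin m → Y)))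
    (t := (Finset.univ : Finset ι))]
  refine Finset.sum_congr rfl fun z _ => Finset.sum_congr rfl fun z' _ => ?_
  rw [← Finset.sum_mul_sum,
    sum_prodWeight_mul_sum_mul_sum hr1 m (fun y => φ y z) fun y => φ y z']
  ring

/-- With `Σ` the second-moment matrix of `φ`, the second moment of the statistic is the squared
Frobenius norm of `mΣ + m(m - 1)μμᵀ`. Its `‖μ‖⁴` term is at most the square of the mean; what
survives is `m²‖Σ‖²` and the mixed term in `μᵀΣμ`. -/
lemma variance_crossStatistic_le {r : Y → ℝ} (hr1 : ∑ y, r y = 1)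
    (hr : ∀ y, 0 ≤ r y) (m : ℕ) (φ : Y → ι → ℝ) (μ : ι → ℝ) (hμ : ∀ z, ∑ y, r y * φ y z = μ z) :
    ∑ a : Fin m → Y, ∑ b : Fin m → Y, prodWeight r a * prodWeight r b *
      (crossStatistic φ a b - (m : ℝ) ^ 2 * ∑ z, μ z ^ 2) ^ 2 ≤
      (m : ℝ) ^ 2 * ∑ y, ∑ y', r y * r y' * (∑ z, φ y z * φ y' z) ^ 2 +
        2 * (m : ℝ) ^ 3 * ∑ y, r y * (∑ z, φ y z * μ z) ^ 2 := by
  set M : ℝ := (m : ℝ) ^ 2 * ∑ z, μ z ^ 2 with hM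
  have e1 := expectation_crossStatistic hr1 m φ
  have e2 := expectation_crossStatistic_sq hr1 m φ
  simp only [hμ] at e1 e2
  rw [← hM] at e1
  have e0 : ∑ a : Fin m → Y, ∑ b : Fin m → Y, prodWeight r a * prodWeight r b = 1 := by
    rw [← Finset.sum_mul_sum, sum_prodWeight hr1, one_mul]
  have hvar : ∑ a : Fin m → Y, ∑ b : Fin m → Y, prodWeight r a * prodWeight r b *
      (crossStatistic φ a b - M) ^ 2 =
      (∑ a : Fin m → Y, ∑ b : Fin m → Y, prodWeight r a * prodWeight r b *
        crossStatistic φ a b ^ 2) - M ^ 2 := by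
    have : ∀ a b : Fin m → Y, prodWeight r a * prodWeight r b * (crossStatistic φ a b - M) ^ 2 =
      prodWeight r a * prodWeight r b * crossStatistic φ a b ^ 2 -
        prodWeight r a * prodWeight r b * crossStatistic φ a b * (2 * M) +
          prodWeight r a * prodWeight r b * M ^ 2 := fun a b => by ring
    simp only [this, Finset.sum_add_distrib, Finset.sum_sub_distrib, ← Finset.sum_mul, e0, e1]
    ring
  -- `‖Σ‖²` is the mean squared inner product of two independent score vectors.
  have hS : ∑ z, ∑ z', (∑ y, r y * (φ y z * φ y z')) ^ 2 =
      ∑ y, ∑ y', r y * r y' * (∑ z, φ y z * φ y' z) ^ 2 := by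
    have h1 : ∀ z z', (∑ y, r y * (φ y z * φ y z')) ^ 2 =
        ∑ y, ∑ y', r y * r y' * ((φ y z * φ y' z) * (φ y z' * φ y' z')) := fun z z' => by
      rw [sq, Finset.sum_mul_sum]
      exact Finset.sum_congr rfl fun y _ => Finset.sum_congr rfl fun y' _ => by ring
    have h2 : ∀ y y', r y * r y' * (∑ z, φ y z * φ y' z) ^ 2 =
        ∑ z, ∑ z', r y * r y' * ((φ y z * φ y' z) * (φ y z' * φ y' z')) := fun y y' => by
      rw [sq, Finset.sum_mul_sum]
      simp only [Finset.mul_sum]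
    simp only [h1, h2]
    simp_rw [Finset.sum_comm (s := (Finset.univ : Finset ι)) (t := (Finset.univ : Finset Y))]
  have hQ : ∑ z, ∑ z', (∑ y, r y * (φ y z * φ y z')) * (μ z * μ z') =
      ∑ y, r y * (∑ z, φ y z * μ z) ^ 2 := by
    have h2 : ∀ y, r y * (∑ z, φ y z * μ z) ^ 2 =
        ∑ z, ∑ z', r y * (φ y z * φ y z') * (μ z * μ z') := fun y => by
      rw [sq, Finset.sum_mul_sum, Finset.mul_sum]
      refine Finset.sum_congr rfl fun z _ => ?_
      rw [Finset.mul_sum]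
      exact Finset.sum_congr rfl fun z' _ => by ring
    simp only [h2, Finset.sum_mul]
    simp_rw [Finset.sum_comm (s := (Finset.univ : Finset ι)) (t := (Finset.univ : Finset Y))]
  have hP : ∑ z, ∑ z', (μ z * μ z') ^ 2 = (∑ z, μ z ^ 2) ^ 2 := by
    rw [sq (∑ z, μ z ^ 2), Finset.sum_mul_sum]
    exact Finset.sum_congr rfl fun y _ => Finset.sum_congr rfl fun y' _ => by ring
  have hexp : ∑ z, ∑ z', (m * ∑ y, r y * (φ y z * φ y z') + m * (m - 1) * (μ z * μ z')) ^ 2 =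
      (m : ℝ) ^ 2 * ∑ y, ∑ y', r y * r y' * (∑ z, φ y z * φ y' z) ^ 2 +
        2 * m ^ 2 * (m - 1) * ∑ y, r y * (∑ z, φ y z * μ z) ^ 2 +
        (m * (m - 1)) ^ 2 * (∑ z, μ z ^ 2) ^ 2 := by
    rw [← hS, ← hQ, ← hP]
    simp only [Finset.mul_sum, ← Finset.sum_add_distrib]
    simp only [← Finset.mul_sum]
    exact Finset.sum_congr rfl fun y _ => Finset.sum_congr rfl fun y' _ => by ring
  rw [hvar, e2, hexp, hM]
  have hQ0 : 0 ≤ ∑ y, r y * (∑ z, φ y z * μ z) ^ 2 :=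
    Finset.sum_nonneg fun y _ => mul_nonneg (hr y) (sq_nonneg _)
  have hm : ((m : ℝ) * (m - 1)) ^ 2 ≤ (m ^ 2) ^ 2 := by
    rcases Nat.eq_zero_or_pos m with rfl | h
    · simp
    · have : (1 : ℝ) ≤ m := by exact_mod_cast h
      exact pow_le_pow_left₀ (by nlinarith) (by nlinarith) 2
  have := mul_le_mul_of_nonneg_right hm (sq_nonneg (∑ z, μ z ^ 2))
  nlinarith [mul_nonneg (sq_nonneg (m : ℝ)) hQ0]

end ProductWeights

/-! ### Message distributions and Chebyshev's inequality for a coinless protocol. -/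

section Messages

variable {X Y : Type} [Fintype X] [Fintype Y]

lemma outputProb_nonneg (W : Channel X Y) (p : stdSimplex ℝ X) (y : Y) : 0 ≤ outputProb W p y :=
  Finset.sum_nonneg fun x _ => mul_nonneg (p.2.1 x) ((W x).2.1 y)

lemma sum_outputProb (W : Channel X Y) (p : stdSimplex ℝ X) : ∑ y, outputProb W p y = 1 := by
  simp only [outputProb]
  rw [Finset.sum_comm]
  simp only [← Finset.mul_sum, stdSimplex.sum_eq_one, mul_one]

lemma messagesProb_nonneg {n : ℕ} (W : Fin n → Channel X Y) (p : stdSimplex ℝ X)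
    (y : Fin n → Y) : 0 ≤ messagesProb W p y :=
  Finset.prod_nonneg fun t _ => outputProb_nonneg (W t) p (y t)

lemma sum_messagesProb {n : ℕ} (W : Fin n → Channel X Y) (p : stdSimplex ℝ X) :
    ∑ y, messagesProb W p y = 1 := by
  classical
  simp only [messagesProb]
  rw [← Fintype.prod_sum fun t => outputProb (W t) p]
  simp [sum_outputProb]

/-- The protocol without coins in which every user uses the channel `W`. -/
def constProtocol {𝒲 : Set (Channel X Y)} {W : Channel X Y} (hW : W ∈ 𝒲) (n : ℕ) :
    PrivateCoinProtocol 𝒲 n where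
  Coin _ := Unit
  law _ := Measure.dirac ()
  chan _ _ := W
  chan_mem _ _ := hW
  measurable_chan _ _ _ := measurable_const

lemma decisionProb_constProtocol {𝒲 : Set (Channel X Y)} {W : Channel X Y} (hW : W ∈ 𝒲) (m : ℕ)
    (T : (Fin (m + m) → Y) → stdSimplex ℝ (Fin 2)) (p : stdSimplex ℝ X) (i : Fin 2) :
    decisionProb (constProtocol hW (m + m)).toPublic (Decision.ofMessages _ T) p i =
      ∑ a : Fin m → Y, ∑ b : Fin m → Y, prodWeight (outputProb W p) a *
        prodWeight (outputProb W p) b * T (Fin.append a b) i := by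
  have h : decisionProb (constProtocol hW (m + m)).toPublic (Decision.ofMessages _ T) p i =
      ∑ y, messagesProb (fun _ => W) p y * T y i := by
    have := (constProtocol hW (m + m)).toPublic.isProbabilityMeasure
    change ∫ _, (∑ y, messagesProb (fun _ => W) p y * T y i)
      ∂(constProtocol hW (m + m)).toPublic.law = _
    rw [integral_const]
    simp
  rw [h, ← (Fin.appendEquiv m m).sum_comp, Fintype.sum_prod_type]
  refine Finset.sum_congr rfl fun a _ => Finset.sum_congr rfl fun b _ => ?_
  simp [messagesProb, prodWeight, Fin.appendEquiv, Fin.prod_univ_add, -Fin.natAdd_eq_addNat]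

/-- Chebyshev's inequality for the probability of the decision `i`. -/
lemma one_sub_le_decisionProb {𝒲 : Set (Channel X Y)} {W : Channel X Y} (hW : W ∈ 𝒲) (m : ℕ)
    (T : (Fin (m + m) → Y) → stdSimplex ℝ (Fin 2)) (p : stdSimplex ℝ X) (i : Fin 2)
    (Z : (Fin m → Y) → (Fin m → Y) → ℝ) (M t V : ℝ)
    (hT : ∀ a b, t * (1 - T (Fin.append a b) i) ≤ (Z a b - M) ^ 2)
    (hV : ∑ a : Fin m → Y, ∑ b : Fin m → Y, prodWeight (outputProb W p) a *
        prodWeight (outputProb W p) b * (Z a b - M) ^ 2 ≤ V) :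
    t * (1 - decisionProb (constProtocol hW (m + m)).toPublic (Decision.ofMessages _ T) p i) ≤
      V := by
  refine le_trans ?_ hV
  have e0 : ∑ a : Fin m → Y, ∑ b : Fin m → Y, prodWeight (outputProb W p) a *
      prodWeight (outputProb W p) b = 1 := by
    rw [← Finset.sum_mul_sum, sum_prodWeight (sum_outputProb W p), one_mul]
  rw [decisionProb_constProtocol, ← e0]
  simp only [← Finset.sum_sub_distrib, Finset.mul_sum]
  refine Finset.sum_le_sum fun a _ => Finset.sum_le_sum fun b _ => ?_
  have h0 : 0 ≤ prodWeight (outputProb W p) a * prodWeight (outputProb W p) b :=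
    mul_nonneg (prodWeight_nonneg (outputProb_nonneg W p) a)
      (prodWeight_nonneg (outputProb_nonneg W p) b)
  nlinarith [mul_le_mul_of_nonneg_left (hT a b) h0]

end Messages

/-! ### Squared Euclidean distance from the uniform distribution. -/

section Uniform

variable {X : Type} [Fintype X]

/-- The squared Euclidean distance of `p` from the uniform distribution. -/
def sqDistUniform (p : stdSimplex ℝ X) : ℝ := ∑ z, (p z - (Fintype.card X : ℝ)⁻¹) ^ 2

lemma sqDistUniform_nonneg (p : stdSimplex ℝ X) : 0 ≤ sqDistUniform p :=
  Finset.sum_nonneg fun _ _ => sq_nonneg _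

/-- Each `p x` is the uniform mass plus a deviation, and no deviation exceeds the Euclidean norm of
all of them. -/
lemma sum_mul_sq_le (p : stdSimplex ℝ X) :
    ∑ x, p x * (p x - (Fintype.card X : ℝ)⁻¹) ^ 2 ≤
      sqDistUniform p * (Fintype.card X : ℝ)⁻¹ + sqDistUniform p * √(sqDistUniform p) := by
  rw [← mul_add]
  set s := √(sqDistUniform p) with hs
  rw [sqDistUniform, Finset.sum_mul]
  refine Finset.sum_le_sum fun x _ => ?_
  rw [mul_comm]
  refine mul_le_mul_of_nonneg_left ?_ (sq_nonneg _)
  have : p x - (Fintype.card X : ℝ)⁻¹ ≤ s :=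
    Real.le_sqrt_of_sq_le (Finset.single_le_sum
      (f := fun z => (p z - (Fintype.card X : ℝ)⁻¹) ^ 2) (fun _ _ => sq_nonneg _)
      (Finset.mem_univ x))
  linarith

variable [Nonempty X]

lemma coe_barycenter (x : X) :
    (stdSimplex.barycenter : stdSimplex ℝ X) x = (Fintype.card X : ℝ)⁻¹ := rfl

lemma sqDistUniform_barycenter :
    sqDistUniform (stdSimplex.barycenter : stdSimplex ℝ X) = 0 := by
  simp [sqDistUniform, coe_barycenter]

lemma card_mul_inv : (Fintype.card X : ℝ) * (Fintype.card X : ℝ)⁻¹ = 1 :=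
  mul_inv_cancel₀ (by exact_mod_cast Fintype.card_ne_zero)

lemma sum_sub_inv_card (p : stdSimplex ℝ X) : ∑ z, (p z - (Fintype.card X : ℝ)⁻¹) = 0 := by
  simp [Finset.sum_sub_distrib, stdSimplex.sum_eq_one]

lemma sum_sq_eq (p : stdSimplex ℝ X) :
    ∑ z, p z ^ 2 = (Fintype.card X : ℝ)⁻¹ + sqDistUniform p := by
  have h : ∀ z, p z ^ 2 = (p z - (Fintype.card X : ℝ)⁻¹) ^ 2 +
      (p z * (2 * (Fintype.card X : ℝ)⁻¹) - (Fintype.card X : ℝ)⁻¹ ^ 2) := fun z => by ring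
  simp only [h, Finset.sum_add_distrib, Finset.sum_sub_distrib, ← Finset.sum_mul,
    stdSimplex.sum_eq_one, sqDistUniform, Finset.sum_const, Finset.card_univ, nsmul_eq_mul]
  linear_combination (-(Fintype.card X : ℝ)⁻¹) * card_mul_inv (X := X)

/-- Cauchy–Schwarz on the set that attains the total variation distance. -/
lemma sq_le_card_mul_sqDistUniform {p : stdSimplex ℝ X} {ε : ℝ} (hε : 0 ≤ ε)
    (h : ε ≤ tvDist p stdSimplex.barycenter) :
    ε ^ 2 ≤ Fintype.card X * sqDistUniform p := by
  obtain ⟨S, hS⟩ := exists_eq_ciSup_of_finite (f := fun S : Finset X =>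
    ∑ x ∈ S, p x - ∑ x ∈ S, (stdSimplex.barycenter : stdSimplex ℝ X) x)
  have h1 : ε ≤ ∑ x ∈ S, (p x - (Fintype.card X : ℝ)⁻¹) := by
    rw [Finset.sum_sub_distrib]
    exact h.trans hS.ge
  calc ε ^ 2 ≤ (∑ x ∈ S, (p x - (Fintype.card X : ℝ)⁻¹)) ^ 2 := pow_le_pow_left₀ hε h1 2
    _ ≤ S.card * ∑ x ∈ S, (p x - (Fintype.card X : ℝ)⁻¹) ^ 2 := sq_sum_le_card_mul_sum_sq
    _ ≤ Fintype.card X * sqDistUniform p := by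
      refine mul_le_mul (by exact_mod_cast Finset.card_le_univ S)
        (Finset.sum_le_sum_of_subset_of_nonneg (Finset.subset_univ S) fun _ _ _ => sq_nonneg _)
        (Finset.sum_nonneg fun _ _ => sq_nonneg _) (Nat.cast_nonneg _)

/-- With `N` symbols the left side is `(1 - 2/N)‖p‖₂² + 1/N²`, and `‖p‖₂² = 1/N + sqDistUniform p`.
-/
lemma sum_mul_mul_sq_le [DecidableEq X] (p : stdSimplex ℝ X) :
    ∑ x, ∑ x', p x * p x' * ((if x = x' then 1 else 0) - (Fintype.card X : ℝ)⁻¹) ^ 2 ≤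
      (Fintype.card X : ℝ)⁻¹ + sqDistUniform p := by
  have h : ∀ x x', p x * p x' * ((if x = x' then 1 else 0) - (Fintype.card X : ℝ)⁻¹) ^ 2 =
      (if x = x' then p x * p x' * (1 - 2 * (Fintype.card X : ℝ)⁻¹) else 0) +
        p x * p x' * (Fintype.card X : ℝ)⁻¹ ^ 2 := fun x x' => by
    split_ifs <;> ring
  simp only [h, Finset.sum_add_distrib, Finset.sum_ite_eq, Finset.mem_univ, if_true,
    ← Finset.sum_mul, ← Finset.mul_sum, stdSimplex.sum_eq_one, ← sq, sum_sq_eq]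
  have h0 : 0 ≤ (Fintype.card X : ℝ)⁻¹ := by positivity
  nlinarith [mul_nonneg h0 (sqDistUniform_nonneg p), mul_nonneg h0 h0]

end Uniform

/-! ### The test statistic for partial erasure channels. -/

section Erasure

variable {X : Type} [Fintype X] [DecidableEq X] (η : unitInterval) (x₀ : X)

lemma outputProb_partialErasure_some (p : stdSimplex ℝ X) (x : X) :
    outputProb (partialErasure η x₀) p (some x) = p x * if x = x₀ then 1 else (η : ℝ) := by
  have : ∀ z, p z * partialErasure η x₀ z (some x) =
      if x = z then p z * (if z = x₀ then 1 else (η : ℝ)) else 0 := fun z => by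
    change p z * (if x = z then (if z = x₀ then 1 else (η : ℝ)) else 0) = _
    split_ifs <;> simp
  rw [outputProb, Finset.sum_congr rfl fun z _ => this z]
  simp

lemma outputProb_partialErasure_none (p : stdSimplex ℝ X) :
    outputProb (partialErasure η x₀) p none = (1 - p x₀) * (1 - (η : ℝ)) := by
  have : ∀ z, p z * partialErasure η x₀ z none =
      p z * (1 - (η : ℝ)) - if z = x₀ then p z * (1 - (η : ℝ)) else 0 := fun z => by
    change p z * (if z = x₀ then 0 else 1 - (η : ℝ)) = _
    split_ifs <;> simp
  rw [outputProb, Finset.sum_congr rfl fun z _ => this z, Finset.sum_sub_distrib,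
    ← Finset.sum_mul, stdSimplex.sum_eq_one]
  simp
  ring

/-- The centred indicator vector of a message of `partialErasure η x₀`, weighted so that its mean is
`η` times the deviation from the uniform distribution. -/
def erasureScore : Option X → X → ℝ
  | none, _ => 0
  | some x, z => (if x = x₀ then (η : ℝ) else 1) *
      ((if x = z then 1 else 0) - (Fintype.card X : ℝ)⁻¹)

lemma erasureScore_none (z : X) : erasureScore η x₀ none z = 0 := rfl

lemma sum_ite_sub_mul (c : ℝ) (x : X) (f : X → ℝ) :
    ∑ z, ((if x = z then 1 else 0) - c) * f z = f x - c * ∑ z, f z := by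
  simp [sub_mul, Finset.sum_sub_distrib, Finset.mul_sum]

lemma sum_outputProb_mul_erasureScore (p : stdSimplex ℝ X) (z : X) :
    ∑ y, outputProb (partialErasure η x₀) p y * erasureScore η x₀ y z =
      η * (p z - (Fintype.card X : ℝ)⁻¹) := by
  rw [Fintype.sum_option]
  have : ∀ x, outputProb (partialErasure η x₀) p (some x) * erasureScore η x₀ (some x) z =
      ((if z = x then 1 else 0) - (Fintype.card X : ℝ)⁻¹) * (η * p x) := fun x => by
    rw [outputProb_partialErasure_some, erasureScore]
    simp only [eq_comm (a := z)]
    split_ifs <;> ring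
  rw [Finset.sum_congr rfl fun x _ => this x, sum_ite_sub_mul, ← Finset.mul_sum,
    stdSimplex.sum_eq_one, erasureScore]
  ring

/-- Away from `x₀` this is an equality; at `x₀` the weight gives `η² p x₀`, smaller since `η ≤ 1`.
Hence the unerased symbol does not worsen the variance. -/
lemma outputProb_mul_sq_le (p : stdSimplex ℝ X) (x : X) :
    outputProb (partialErasure η x₀) p (some x) * (if x = x₀ then (η : ℝ) else 1) ^ 2 ≤
      η * p x := by
  rw [outputProb_partialErasure_some]
  have h0 := η.2.1
  have h1 := η.2.2
  have hp := p.2.1 x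
  have hp' : 0 ≤ p x := hp
  split_ifs
  · nlinarith [mul_le_mul_of_nonneg_right h1 (mul_nonneg h0 hp')]
  · nlinarith

/-- The test that compares the statistic with the threshold `τ`. -/
def thresholdTest (τ : ℝ) {m : ℕ} (y : Fin (m + m) → Option X) : stdSimplex ℝ (Fin 2) :=
  if τ ≤ crossStatistic (erasureScore η x₀) (fun t => y (Fin.castAdd m t))
    (fun t => y (Fin.natAdd m t)) then stdSimplex.vertex 1 else stdSimplex.vertex 0

lemma thresholdTest_append (τ : ℝ) {m : ℕ} (a b : Fin m → Option X) :
    thresholdTest η x₀ τ (Fin.append a b) =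
      if τ ≤ crossStatistic (erasureScore η x₀) a b then stdSimplex.vertex 1
        else stdSimplex.vertex 0 := by
  simp [thresholdTest, -Fin.natAdd_eq_addNat]

variable [Nonempty X]

lemma sum_erasureScore_mul_erasureScore (x x' : X) :
    ∑ z, erasureScore η x₀ (some x) z * erasureScore η x₀ (some x') z =
      (if x = x₀ then (η : ℝ) else 1) * (if x' = x₀ then (η : ℝ) else 1) *
        ((if x = x' then 1 else 0) - (Fintype.card X : ℝ)⁻¹) := by
  have : ∀ z, erasureScore η x₀ (some x) z * erasureScore η x₀ (some x') z =
      ((if x = z then 1 else 0) - (Fintype.card X : ℝ)⁻¹) *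
        ((if x = x₀ then (η : ℝ) else 1) * (if x' = x₀ then (η : ℝ) else 1) *
        ((if x' = z then 1 else 0) - (Fintype.card X : ℝ)⁻¹)) := fun z => by
    simp only [erasureScore]
    ring
  have h0 : ∑ z, ((if x' = z then 1 else 0) - (Fintype.card X : ℝ)⁻¹) = 0 := by
    simp [Finset.sum_sub_distrib]
  rw [Finset.sum_congr rfl fun z _ => this z, sum_ite_sub_mul, ← Finset.mul_sum, h0]
  simp only [mul_zero, sub_zero, eq_comm (a := x')]

lemma sum_erasureScore_mul_sub (p : stdSimplex ℝ X) (x : X) :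
    ∑ z, erasureScore η x₀ (some x) z * (η * (p z - (Fintype.card X : ℝ)⁻¹)) =
      (if x = x₀ then (η : ℝ) else 1) * (η * (p x - (Fintype.card X : ℝ)⁻¹)) := by
  simp only [erasureScore, mul_assoc, ← Finset.mul_sum, sum_ite_sub_mul, sum_sub_inv_card]
  ring

/-- The variance of the test statistic is at most the one for a sample that is erased with
probability `1 - η` independently of its value. -/
lemma variance_erasureScore_le (p : stdSimplex ℝ X) (m : ℕ) :
    ∑ a : Fin m → Option X, ∑ b : Fin m → Option X,
      prodWeight (outputProb (partialErasure η x₀) p) a *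
        prodWeight (outputProb (partialErasure η x₀) p) b *
        (crossStatistic (erasureScore η x₀) a b - (m * η) ^ 2 * sqDistUniform p) ^ 2 ≤
      (m * η) ^ 2 * ((Fintype.card X : ℝ)⁻¹ + sqDistUniform p) + 2 * (m * η) ^ 3 *
        (sqDistUniform p * (Fintype.card X : ℝ)⁻¹ + sqDistUniform p * √(sqDistUniform p)) := by
  have h := variance_crossStatistic_le (sum_outputProb (partialErasure η x₀) p)
    (outputProb_nonneg _ p) m (erasureScore η x₀) _
    (sum_outputProb_mul_erasureScore η x₀ p)
  have hM : (m : ℝ) ^ 2 * ∑ z, ((η : ℝ) * (p z - (Fintype.card X : ℝ)⁻¹)) ^ 2 =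
      (m * η) ^ 2 * sqDistUniform p := by
    simp only [mul_pow, ← Finset.mul_sum, sqDistUniform]
    ring
  rw [hM] at h
  refine h.trans ?_
  have hη : 0 ≤ (η : ℝ) := η.2.1
  have hp : ∀ x, 0 ≤ p x := p.2.1
  have hr := outputProb_nonneg (partialErasure η x₀) p
  refine add_le_add ?_ ?_
  -- The erasure message has score zero, and each of the two symbols contributes a factor at most `η
  -- p`.
  · rw [mul_pow, mul_assoc]
    refine mul_le_mul_of_nonneg_left ?_ (sq_nonneg _)
    refine le_trans ?_ (mul_le_mul_of_nonneg_left (sum_mul_mul_sq_le p) (sq_nonneg _))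
    rw [Fintype.sum_option]
    simp only [Fintype.sum_option, sum_erasureScore_mul_erasureScore, erasureScore_none, zero_mul,
      mul_zero, Finset.sum_const_zero, ne_eq, OfNat.ofNat_ne_zero, not_false_eq_true, zero_pow,
      zero_add, Finset.mul_sum]
    refine Finset.sum_le_sum fun x _ => Finset.sum_le_sum fun x' _ => ?_
    have := mul_le_mul (outputProb_mul_sq_le η x₀ p x) (outputProb_mul_sq_le η x₀ p x')
      (mul_nonneg (hr _) (sq_nonneg _)) (mul_nonneg hη (hp x))
    have := mul_le_mul_of_nonneg_right this
      (sq_nonneg ((if x = x' then 1 else 0) - (Fintype.card X : ℝ)⁻¹))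
    calc _ = _ := by ring
      _ ≤ _ := this
      _ = _ := by ring
  -- Of the factor `η³`, two powers come from the mean `η(p - u)` and one from the output
  -- probability.
  · rw [mul_pow, ← mul_assoc, mul_assoc (2 * (m : ℝ) ^ 3)]
    refine mul_le_mul_of_nonneg_left ?_ (by positivity)
    refine le_trans ?_ (mul_le_mul_of_nonneg_left (sum_mul_sq_le p) (pow_nonneg hη 3))
    rw [Fintype.sum_option]
    simp only [sum_erasureScore_mul_sub, erasureScore_none, zero_mul, Finset.sum_const_zero, ne_eq,
      OfNat.ofNat_ne_zero, not_false_eq_true, zero_pow, mul_zero, zero_add, Finset.mul_sum]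
    refine Finset.sum_le_sum fun x _ => ?_
    have := mul_le_mul_of_nonneg_right (outputProb_mul_sq_le η x₀ p x)
      (sq_nonneg ((η : ℝ) * (p x - (Fintype.card X : ℝ)⁻¹)))
    calc _ = _ := by ring
      _ ≤ _ := this
      _ = _ := by ring

end Erasure

/-! ### Calibration of the test and its sample size. -/

lemma invSqrt_sq {k : ℕ} (hk : k ≠ 0) : (invSqrt k : ℝ) ^ 2 = 1 / k := by
  have : (0 : ℝ) < k := by exact_mod_cast Nat.pos_of_ne_zero hk
  simp [invSqrt, Real.sq_sqrt this.le]

/-- Here `u = mη`, `d = ‖p - u‖₂` and `K = √k`, so the alphabet has size `2K²`; the right side is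
what Chebyshev needs for a deviation of half the mean `u²d²`. Put `P = ud` and `Q = ud²K`. The right
side is split into equal parts `P⁴/800` and `(u/K)²Q²/800`: the first absorbs the noise terms in `P²
+ 2P³`, the second those in `(u/K)²(1/2 + Q)`. -/
lemma variance_bound_le {u d K : ℝ} (hu : 0 < u) (hK : 1 ≤ K) (hP : 2000 ≤ u * d)
    (hQ : 2000 ≤ u * d ^ 2 * K) :
    u ^ 2 * ((2 * K ^ 2)⁻¹ + d ^ 2) + 2 * u ^ 3 * (d ^ 2 * (2 * K ^ 2)⁻¹ + d ^ 2 * d) ≤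
      (u ^ 2 * d ^ 2 / 2) ^ 2 * (1 / 100) := by
  have hK0 : 0 < K := by linarith
  have e1 : u ^ 2 * ((2 * K ^ 2)⁻¹ + d ^ 2) + 2 * u ^ 3 * (d ^ 2 * (2 * K ^ 2)⁻¹ + d ^ 2 * d) =
      (u / K) ^ 2 / 2 + (u * d) ^ 2 + (u / K) ^ 2 * (u * d ^ 2 * K) / K + 2 * (u * d) ^ 3 := by
    field_simp
    ring
  have e2 : (u ^ 2 * d ^ 2 / 2) ^ 2 * (1 / 100) =
      (u * d) ^ 4 / 800 + (u / K) ^ 2 * (u * d ^ 2 * K) ^ 2 / 800 := by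
    field_simp
    ring
  rw [e1, e2]
  generalize u * d ^ 2 * K = Q at *
  generalize u * d = P at *
  have hR : 0 ≤ (u / K) ^ 2 := sq_nonneg _
  generalize (u / K) ^ 2 = R at *
  have hK' : R * Q / K ≤ R * Q := div_le_self (mul_nonneg hR (by linarith)) hK
  have hP2 : P ^ 2 * (1 + 2 * P) ≤ P ^ 2 * (P ^ 2 / 800) :=
    mul_le_mul_of_nonneg_left (by nlinarith) (sq_nonneg P)
  have hQ2 : R * (1 / 2 + Q) ≤ R * (Q ^ 2 / 800) := mul_le_mul_of_nonneg_left (by nlinarith) hR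
  linarith

theorem add_self_mem_privateCoinTestSizes (k : ℕ) [NeZero k] {ε : ℝ} (hε : 0 < ε) (hε1 : ε ≤ 1)
    {m : ℕ} (hm : 4000 * (k / ε ^ 2) ≤ m) :
    m + m ∈ privateCoinTestSizes (partialErasureFamily (Fin (2 * k)) (invSqrt k)) ε := by
  set η := invSqrt k
  have hk : (1 : ℝ) ≤ k := by exact_mod_cast NeZero.one_le
  set K : ℝ := √(k : ℝ) with hK
  have hKk : K ^ 2 = k := Real.sq_sqrt (by linarith)
  have hK1 : 1 ≤ K := Real.one_le_sqrt.mpr hk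
  have hηK : (η : ℝ) = 1 / K := rfl
  set u : ℝ := m * η with hu
  have hu1 : 4000 * (K / ε ^ 2) ≤ u := by
    rw [hu, hηK, mul_one_div, le_div_iff₀ (by linarith)]
    calc _ = 4000 * (K ^ 2 / ε ^ 2) := by ring
      _ ≤ m := by rwa [hKk]
  have hu0 : 0 < u := lt_of_lt_of_le (by positivity) hu1
  have hcard : (Fintype.card (Fin (2 * k)) : ℝ) = 2 * K ^ 2 := by simp [hKk]
  -- Any symbol would do.
  let x₀ : Fin (2 * k) := 0
  -- Half the lower bound for the mean `u² * sqDistUniform p` over the alternatives, by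
  -- Cauchy–Schwarz.
  set τ : ℝ := u ^ 2 * (ε ^ 2 / (2 * K ^ 2)) / 2 with hτ
  have hτ0 : 0 < τ := by positivity
  have huε : 4000 * K ≤ u * ε ^ 2 := by
    rw [← mul_div_assoc, div_le_iff₀ (by positivity)] at hu1
    exact hu1
  have hfin : ∀ q : ℝ, 1 - q ≤ 1 / 100 → 99 / 100 ≤ q := fun q hq => by linarith
  refine ⟨constProtocol (W := partialErasure η x₀) (Set.mem_range_self x₀) (m + m),
    thresholdTest η x₀ τ, ?_,
    fun p hp => ?_⟩
  -- Under uniformity the mean is zero, so an error is a deviation of at least `τ`.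
  · have h := one_sub_le_decisionProb (𝒲 := partialErasureFamily (Fin (2 * k)) η)
      (W := partialErasure η x₀) (Set.mem_range_self x₀) m (thresholdTest η x₀ τ)
      stdSimplex.barycenter 0 (crossStatistic (erasureScore η x₀)) _
      (τ ^ 2) _ ?_ (variance_erasureScore_le η x₀ stdSimplex.barycenter m)
    · rw [sqDistUniform_barycenter, hcard, ← hu] at h
      have h2 : u ^ 2 * ((2 * K ^ 2)⁻¹ + 0) + 2 * u ^ 3 * (0 * (2 * K ^ 2)⁻¹ + 0 * √0) ≤
          τ ^ 2 * (1 / 100) := by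
        have h3 : (4000 * K) ^ 2 ≤ (u * ε ^ 2) ^ 2 := pow_le_pow_left₀ (by positivity) huε 2
        have h4 : τ ^ 2 * (1 / 100) = (u / K ^ 2) ^ 2 * (u * ε ^ 2) ^ 2 / 1600 := by
          rw [hτ]; field_simp; ring
        have h5 : u ^ 2 * ((2 * K ^ 2)⁻¹ + 0) + 2 * u ^ 3 * (0 * (2 * K ^ 2)⁻¹ + 0 * √0) =
            (u / K ^ 2) ^ 2 * K ^ 2 / 2 := by
          field_simp; ring
        rw [h4, h5]
        nlinarith [mul_le_mul_of_nonneg_left h3 (sq_nonneg (u / K ^ 2)),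
          mul_nonneg (sq_nonneg (u / K ^ 2)) (sq_nonneg K)]
      exact hfin _ (le_of_mul_le_mul_left (h.trans h2) (by positivity))
    · intro a b
      rw [thresholdTest_append, sqDistUniform_barycenter, mul_zero, sub_zero]
      split_ifs with hle
      · simpa using pow_le_pow_left₀ hτ0.le hle 2
      · simp [sq_nonneg]
  · have hD := sq_le_card_mul_sqDistUniform hε.le hp
    rw [hcard] at hD
    set D := sqDistUniform p with hDdef
    have hD0 : 0 ≤ D := sqDistUniform_nonneg p
    have hDε : ε ^ 2 / (2 * K ^ 2) ≤ D := by
      rw [div_le_iff₀ (by positivity)]; linarith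
    have hD1 : 0 < D := lt_of_lt_of_le (by positivity) hDε
    have hτD : 2 * τ ≤ u ^ 2 * D := by
      rw [hτ]; nlinarith [mul_le_mul_of_nonneg_left hDε (sq_nonneg u)]
    -- The mean `u²D` is at least `2τ`, so an error is a deviation of at least half the mean.
    have h := one_sub_le_decisionProb (𝒲 := partialErasureFamily (Fin (2 * k)) η)
      (W := partialErasure η x₀) (Set.mem_range_self x₀) m (thresholdTest η x₀ τ) p 1
      (crossStatistic (erasureScore η x₀)) _
      ((u ^ 2 * D / 2) ^ 2) _ ?_ (variance_erasureScore_le η x₀ p m)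
    · rw [hcard, ← hu, ← hDdef] at h
      set d := √D with hd
      have hd2 : d ^ 2 = D := Real.sq_sqrt hD0
      have hd0 : 0 ≤ d := Real.sqrt_nonneg D
      have hQ : 2000 ≤ u * d ^ 2 * K := by
        rw [hd2]
        have : 4000 * K * D ≥ 4000 * K * (ε ^ 2 / (2 * K ^ 2)) :=
          mul_le_mul_of_nonneg_left hDε (by positivity)
        have e : 4000 * K * (ε ^ 2 / (2 * K ^ 2)) = 2000 * ε ^ 2 / K := by field_simp; norm_num
        rw [e, ge_iff_le, div_le_iff₀ (by linarith)] at this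
        have h6 := mul_le_mul_of_nonneg_right huε (mul_nonneg hD0 (by linarith : 0 ≤ K))
        have : 2000 * ε ^ 2 ≤ (u * D * K) * ε ^ 2 := by nlinarith
        exact le_of_mul_le_mul_right this (by positivity)
      -- One of the two factors `ε²` in `(uε²)²` is absorbed by `D`, the other by `ε ≤ 1`.
      have hP : 2000 ≤ u * d := by
        refine le_of_sq_le_sq ?_ (by positivity)
        rw [mul_pow, hd2]
        have h6 : (4000 * K) ^ 2 ≤ (u * ε ^ 2) ^ 2 := pow_le_pow_left₀ (by positivity) huε 2
        have h7 : (u * ε ^ 2) ^ 2 ≤ (u ^ 2 * D) * (2 * K ^ 2) * ε ^ 2 := by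
          nlinarith [mul_le_mul_of_nonneg_left hD (mul_nonneg (sq_nonneg u) (sq_nonneg ε))]
        have h8 : (u ^ 2 * D) * (2 * K ^ 2) * ε ^ 2 ≤ (u ^ 2 * D) * (2 * K ^ 2) * 1 :=
          mul_le_mul_of_nonneg_left (pow_le_one₀ hε.le hε1) (by positivity)
        have h9 : 8000000 * (2 * K ^ 2) ≤ (u ^ 2 * D) * (2 * K ^ 2) := by linarith
        have := le_of_mul_le_mul_right h9 (by positivity)
        linarith
      have h2 : u ^ 2 * ((2 * K ^ 2)⁻¹ + D) + 2 * u ^ 3 * (D * (2 * K ^ 2)⁻¹ + D * d) ≤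
          (u ^ 2 * D / 2) ^ 2 * (1 / 100) := by
        rw [← hd2]
        exact variance_bound_le hu0 hK1 hP hQ
      exact hfin _ (le_of_mul_le_mul_left (h.trans h2) (by positivity))
    · intro a b
      rw [thresholdTest_append]
      split_ifs with hle
      · simp [sq_nonneg]
      · have hlt := not_lt.mp fun h => hle (le_of_lt h)
        rw [stdSimplex.vertex_coe, Pi.single_eq_of_ne (by decide), sub_zero, mul_one, ← hu,
          ← neg_sq (_ - _)]
        exact pow_le_pow_left₀ (by positivity) (by linarith) 2

/-! ### Average power against a finite family of alternatives. -/

section Decision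

variable {X Y : Type} [Fintype X] [Fintype Y] {𝒲 : Set (Channel X Y)} {n : ℕ}

lemma integrable_decision (P : PublicCoinProtocol 𝒲 n) (T : Decision P) (p : stdSimplex ℝ X)
    (b : Fin 2) :
    Integrable (fun u => ∑ y, messagesProb (fun t => P.chan t u) p y * T.dec y u b) P.law := by
  refine Integrable.of_bound (C := 1) (Measurable.aestronglyMeasurable ?_) (.of_forall fun u => ?_)
  · refine Finset.measurable_sum _ fun y _ => Measurable.mul ?_ (T.measurable_dec y b)
    exact Finset.measurable_prod _ fun t _ => Finset.measurable_sum _ fun x _ =>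
      measurable_const.mul (P.measurable_chan t x (y t))
  · have h0 : ∀ y, 0 ≤ messagesProb (fun t => P.chan t u) p y * T.dec y u b := fun y =>
      mul_nonneg (messagesProb_nonneg _ p y) ((T.dec y u).2.1 b)
    rw [Real.norm_of_nonneg (Finset.sum_nonneg fun y _ => h0 y),
      ← sum_messagesProb (fun t => P.chan t u) p]
    exact Finset.sum_le_sum fun y _ =>
      mul_le_of_le_one_right (messagesProb_nonneg _ p y) (stdSimplex.le_one _ b)

lemma decisionProb_zero_add_one (P : PublicCoinProtocol 𝒲 n) (T : Decision P)
    (p : stdSimplex ℝ X) : decisionProb P T p 0 + decisionProb P T p 1 = 1 := by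
  rw [decisionProb, decisionProb, ← integral_add (integrable_decision P T p 0)
    (integrable_decision P T p 1)]
  have : ∀ u, (∑ y, messagesProb (fun t => P.chan t u) p y * T.dec y u 0) +
      ∑ y, messagesProb (fun t => P.chan t u) p y * T.dec y u 1 = 1 := fun u => by
    rw [← Finset.sum_add_distrib, ← sum_messagesProb (fun t => P.chan t u) p]
    refine Finset.sum_congr rfl fun y _ => ?_
    rw [← mul_add, stdSimplex.add_eq_one, mul_one]
  simp [this]

/-- A bound on the second moment of the average likelihood ratio of a finite family `q` of
alternatives to `p` bounds the average power of any test. -/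
lemma sum_decisionProb_le {ζ : Type} [Fintype ζ] [Nonempty ζ] (P : PublicCoinProtocol 𝒲 n)
    (T : Decision P) (p : stdSimplex ℝ X) (q : ζ → stdSimplex ℝ X) {M : ℝ}
    (h : ∀ u, ∃ L : ζ → (Fin n → Y) → ℝ,
      (∀ z y, messagesProb (fun t => P.chan t u) (q z) y =
        messagesProb (fun t => P.chan t u) p y * L z y) ∧
      ∑ z, ∑ z', ∑ y, messagesProb (fun t => P.chan t u) p y * (L z y * L z' y) ≤
        (Fintype.card ζ : ℝ) ^ 2 * M) :
    ∑ z, decisionProb P T (q z) 1 ≤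
      Fintype.card ζ * (10 * decisionProb P T p 1 + M / 40) := by
  have hc : (0 : ℝ) < Fintype.card ζ := by exact_mod_cast Fintype.card_pos
  have key : ∀ u, ∑ z, ∑ y, messagesProb (fun t => P.chan t u) (q z) y * T.dec y u 1 ≤
      Fintype.card ζ * (10 * (∑ y, messagesProb (fun t => P.chan t u) p y * T.dec y u 1) +
        M / 40) := by
    intro u
    obtain ⟨L, hL, hM⟩ := h u
    set w := messagesProb (fun t => P.chan t u) p with hw
    have e1 : ∑ z, ∑ z', ∑ y, w y * (L z y * L z' y) = ∑ y, w y * (∑ z, L z y) ^ 2 := by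
      have : ∀ y, w y * (∑ z, L z y) ^ 2 = ∑ z, ∑ z', w y * (L z y * L z' y) := fun y => by
        rw [sq, Finset.sum_mul_sum, Finset.mul_sum]
        simp only [Finset.mul_sum]
      simp only [this]
      simp_rw [Finset.sum_comm (s := (Finset.univ : Finset ζ))
        (t := (Finset.univ : Finset (Fin n → Y)))]
    have e2 : ∑ z, ∑ y, messagesProb (fun t => P.chan t u) (q z) y * T.dec y u 1 =
        ∑ y, w y * (T.dec y u 1 * ∑ z, L z y) := by
      rw [Finset.sum_comm]
      refine Finset.sum_congr rfl fun y _ => ?_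
      rw [Finset.mul_sum, Finset.mul_sum]
      exact Finset.sum_congr rfl fun z _ => by rw [hL]; ring
    -- Weighted AM–GM, using `f² ≤ f` for `0 ≤ f ≤ 1`. The weights 10 and 1/40 make the final bound
    -- `10/100 + 2/40`, below 99/100, when `M = 2`.
    have hb : ∀ y, T.dec y u 1 * ∑ z, L z y ≤ Fintype.card ζ * 10 * T.dec y u 1 +
        (Fintype.card ζ : ℝ)⁻¹ / 40 * (∑ z, L z y) ^ 2 := by
      intro y
      have f0 : 0 ≤ T.dec y u 1 := (T.dec y u).2.1 1
      have f1 : T.dec y u 1 ≤ 1 := stdSimplex.le_one _ 1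
      generalize T.dec y u 1 = f at *
      generalize ∑ z, L z y = s at *
      have e : Fintype.card ζ * 10 * f ^ 2 + (Fintype.card ζ : ℝ)⁻¹ / 40 * s ^ 2 - f * s =
          (Fintype.card ζ : ℝ)⁻¹ / 40 * (20 * Fintype.card ζ * f - s) ^ 2 := by
        field_simp
        ring
      have : 0 ≤ (Fintype.card ζ : ℝ)⁻¹ / 40 * (20 * Fintype.card ζ * f - s) ^ 2 := by positivity
      nlinarith [mul_nonneg hc.le (mul_nonneg f0 (sub_nonneg.mpr f1))]
    rw [e1] at hM
    rw [e2]
    calc ∑ y, w y * (T.dec y u 1 * ∑ z, L z y)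
        ≤ ∑ y, w y * (Fintype.card ζ * 10 * T.dec y u 1 +
            (Fintype.card ζ : ℝ)⁻¹ / 40 * (∑ z, L z y) ^ 2) :=
          Finset.sum_le_sum fun y _ =>
            mul_le_mul_of_nonneg_left (hb y) (messagesProb_nonneg _ p y)
      _ = Fintype.card ζ * 10 * (∑ y, w y * T.dec y u 1) +
            (Fintype.card ζ : ℝ)⁻¹ / 40 * ∑ y, w y * (∑ z, L z y) ^ 2 := by
          rw [Finset.mul_sum, Finset.mul_sum, ← Finset.sum_add_distrib]
          exact Finset.sum_congr rfl fun y _ => by ring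
      _ ≤ Fintype.card ζ * 10 * (∑ y, w y * T.dec y u 1) +
            (Fintype.card ζ : ℝ)⁻¹ / 40 * ((Fintype.card ζ : ℝ) ^ 2 * M) := by gcongr
      _ = _ := by field_simp
  simp only [decisionProb]
  rw [← integral_finsetSum _ fun z _ => integrable_decision P T (q z) 1]
  refine (integral_mono (integrable_finsetSum _ fun z _ => integrable_decision P T (q z) 1)
    ((((integrable_decision P T p 1).const_mul 10).add (integrable_const (M / 40))).const_mul _)
    key).trans_eq ?_
  simp only [Pi.add_apply]
  rw [integral_const_mul, integral_add ((integrable_decision P T p 1).const_mul 10)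
    (integrable_const _), integral_const_mul, integral_const]
  simp

end Decision

/-! ### Rademacher sums. -/

section SignVectors

/-- The sign `±1` of a Boolean. -/
def boolSign (b : Bool) : ℝ := if b then 1 else -1

lemma boolSign_mul_self (b : Bool) : boolSign b * boolSign b = 1 := by
  cases b <;> simp [boolSign]

lemma abs_boolSign (b : Bool) : |boolSign b| = 1 := by
  cases b <;> simp [boolSign]

variable {I : Type} [Fintype I] [DecidableEq I]

/-- The moment generating function of a Rademacher sum is sub-Gaussian. -/
lemma sum_exp_sum_boolSign_le (c : I → ℝ) (z : I → Bool) :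
    ∑ z' : I → Bool, Real.exp (∑ i, c i * (boolSign (z i) * boolSign (z' i))) ≤
      (Fintype.card (I → Bool) : ℝ) * Real.exp ((∑ i, c i ^ 2) / 2) := by
  simp only [Real.exp_sum]
  rw [← Fintype.prod_sum fun i b => Real.exp (c i * (boolSign (z i) * boolSign b))]
  have h : ∀ i, ∑ b, Real.exp (c i * (boolSign (z i) * boolSign b)) = 2 * Real.cosh (c i) := by
    intro i
    rw [Real.cosh_eq]
    cases z i <;> simp [boolSign] <;> ring
  simp only [h, Finset.prod_mul_distrib, Finset.sum_div, Real.exp_sum]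
  refine mul_le_mul (by simp) (Finset.prod_le_prod (fun i _ => (Real.cosh_pos _).le)
    fun i _ => Real.cosh_le_exp_half_sq _) (Finset.prod_nonneg fun i _ => (Real.cosh_pos _).le)
    (Nat.cast_nonneg _)

end SignVectors

/-! ### Paired perturbations of the uniform law and their likelihood ratios. -/

section PairedPerturbation

variable {X I : Type} (e : X ≃ Bool × I)

/-- The sign of the perturbation of the probability of `x`: opposite for the two elements of
each pair. -/
def pairSign (z : I → Bool) (x : X) : ℝ := boolSign (e x).1 * boolSign (z (e x).2)

lemma abs_pairSign (z : I → Bool) (x : X) : |pairSign e z x| = 1 := by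
  simp [pairSign, abs_mul, abs_boolSign]

lemma pairSign_mul_pairSign (z z' : I → Bool) (x : X) :
    pairSign e z x * pairSign e z' x = boolSign (z (e x).2) * boolSign (z' (e x).2) := by
  simp only [pairSign]
  linear_combination boolSign (z (e x).2) * boolSign (z' (e x).2) * boolSign_mul_self (e x).1

variable [Fintype X] [Fintype I]

lemma sum_pairSign (z : I → Bool) : ∑ x, pairSign e z x = 0 := by
  rw [← e.symm.sum_comp, Fintype.sum_prod_type]
  simp only [Fintype.sum_bool, ← Finset.sum_add_distrib, pairSign, Equiv.apply_symm_apply]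
  exact Finset.sum_eq_zero fun i _ => by cases z i <;> simp [boolSign]

lemma sum_pairSign_mul_pairSign (z z' : I → Bool) :
    ∑ x, pairSign e z x * pairSign e z' x = 2 * ∑ i, boolSign (z i) * boolSign (z' i) := by
  simp only [pairSign_mul_pairSign]
  rw [← e.symm.sum_comp, Fintype.sum_prod_type]
  simp [two_mul]

variable [Nonempty X] {ε : ℝ}

/-- The uniform distribution perturbed by the factors `1 ± 2 * ε` on each pair. -/
def pairPerturbed (hε : 0 ≤ ε) (hε2 : ε ≤ 1 / 2) (z : I → Bool) : stdSimplex ℝ X :=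
  ⟨fun x => (Fintype.card X : ℝ)⁻¹ * (1 + 2 * ε * pairSign e z x), fun x => by
    have := neg_le_of_abs_le (abs_pairSign e z x).le
    exact mul_nonneg (by positivity) (by nlinarith), by
    rw [← Finset.mul_sum, Finset.sum_add_distrib, ← Finset.mul_sum, sum_pairSign]
    simp⟩

lemma pairPerturbed_apply (hε : 0 ≤ ε) (hε2 : ε ≤ 1 / 2) (z : I → Bool) (x : X) :
    pairPerturbed e hε hε2 z x = (Fintype.card X : ℝ)⁻¹ * (1 + 2 * ε * pairSign e z x) := rfl

lemma le_tvDist_pairPerturbed (hε : 0 ≤ ε) (hε2 : ε ≤ 1 / 2) (z : I → Bool) :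
    ε ≤ tvDist (pairPerturbed e hε hε2 z) stdSimplex.barycenter := by
  classical
  refine le_trans (le_of_eq ?_) (le_ciSup (f := fun S : Finset X =>
    ∑ x ∈ S, pairPerturbed e hε hε2 z x - ∑ x ∈ S, (stdSimplex.barycenter : stdSimplex ℝ X) x)
    (Set.finite_range _).bddAbove (Finset.univ.filter fun x => pairSign e z x = 1))
  rw [← Finset.sum_sub_distrib, Finset.sum_filter]
  have : ∀ x, (if pairSign e z x = 1 then
      pairPerturbed e hε hε2 z x - (stdSimplex.barycenter : stdSimplex ℝ X) x else 0) =
      (Fintype.card X : ℝ)⁻¹ * ε + (Fintype.card X : ℝ)⁻¹ * ε * pairSign e z x := fun x => by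
    rw [pairPerturbed_apply, coe_barycenter]
    rcases eq_or_eq_neg_of_abs_eq (abs_pairSign e z x) with h | h <;> rw [h]
    · simp; ring
    · rw [if_neg (by norm_num)]; ring
  simp only [this, Finset.sum_add_distrib, ← Finset.mul_sum, sum_pairSign, Finset.sum_const,
    Finset.card_univ, nsmul_eq_mul]
  linear_combination (-ε) * card_mul_inv (X := X)

lemma one_lt_card_of_equiv (e : X ≃ Bool × I) : (1 : ℝ) < Fintype.card X := by
  have : 0 < Fintype.card X := Fintype.card_pos
  have h := Fintype.card_congr e
  rw [Fintype.card_prod, Fintype.card_bool] at h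
  exact_mod_cast (by omega : 1 < Fintype.card X)

/-- The relative change of the message probabilities of `partialErasure η x₀` when the uniform
distribution is perturbed. -/
def relChange (x₀ : X) (ε : ℝ) (z : I → Bool) : Option X → ℝ
  | none => -(2 * ε * pairSign e z x₀ / (Fintype.card X - 1))
  | some x => 2 * ε * pairSign e z x

lemma one_add_relChange_nonneg (x₀ : X) (hε : 0 ≤ ε) (hε2 : ε ≤ 1 / 2) (z : I → Bool)
    (y : Option X) :
    0 ≤ 1 + relChange e x₀ ε z y := by
  have h1 := one_lt_card_of_equiv e
  have h2 : (2 : ℝ) ≤ Fintype.card X := by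
    exact_mod_cast (by exact_mod_cast h1 : 1 < Fintype.card X)
  have hs : ∀ x, |2 * ε * pairSign e z x| ≤ 1 := fun x => by
    rw [abs_mul, abs_pairSign, mul_one, abs_of_nonneg (by linarith)]
    linarith
  rcases y with _ | x
  · rw [relChange]
    have : 2 * ε * pairSign e z x₀ / (Fintype.card X - 1) ≤ 1 := by
      rw [div_le_one (by linarith)]
      linarith [le_of_abs_le (hs x₀)]
    linarith
  · rw [relChange]
    linarith [neg_le_of_abs_le (hs x)]

variable [DecidableEq X] (η : unitInterval) (x₀ : X)

/-- The erasure message occurs only for symbols other than `x₀`, whose total mass moves opposite to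
that of `x₀`; relative to `card X - 1` uniform atoms, this gives the divisor in `relChange`. -/
lemma outputProb_pairPerturbed (hε : 0 ≤ ε) (hε2 : ε ≤ 1 / 2) (z : I → Bool) (y : Option X) :
    outputProb (partialErasure η x₀) (pairPerturbed e hε hε2 z) y =
      outputProb (partialErasure η x₀) stdSimplex.barycenter y *
        (1 + relChange e x₀ ε z y) := by
  have h1 := one_lt_card_of_equiv e
  have h2 : (Fintype.card X : ℝ) - 1 ≠ 0 := by linarith
  have h3 : (Fintype.card X : ℝ) ≠ 0 := by linarith
  rcases y with _ | x
  · rw [outputProb_partialErasure_none, outputProb_partialErasure_none, pairPerturbed_apply,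
      coe_barycenter, relChange]
    field_simp
    ring
  · rw [outputProb_partialErasure_some, outputProb_partialErasure_some, pairPerturbed_apply,
      coe_barycenter, relChange]
    ring

lemma sum_outputProb_mul_relChange (hε : 0 ≤ ε) (hε2 : ε ≤ 1 / 2) (z : I → Bool) :
    ∑ y, outputProb (partialErasure η x₀) stdSimplex.barycenter y * relChange e x₀ ε z y = 0 := by
  have h := sum_outputProb (partialErasure η x₀) (pairPerturbed e hε hε2 z)
  simp only [outputProb_pairPerturbed, mul_add, mul_one, Finset.sum_add_distrib,
    sum_outputProb] at h
  linarith

variable [DecidableEq I]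

/-- The correlation of the perturbed message distributions. -/
lemma sum_outputProb_mul_likelihood (hε : 0 ≤ ε) (hε2 : ε ≤ 1 / 2) (z z' : I → Bool) :
    ∑ y, outputProb (partialErasure η x₀) stdSimplex.barycenter y *
      ((1 + relChange e x₀ ε z y) * (1 + relChange e x₀ ε z' y)) =
    1 + ∑ i, 4 * ε ^ 2 * (Fintype.card X : ℝ)⁻¹ * (2 * η +
      (1 - η) * (((Fintype.card X : ℝ) - 1)⁻¹ + 1) * if (e x₀).2 = i then 1 else 0) *
        (boolSign (z i) * boolSign (z' i)) := by
  have h1 := one_lt_card_of_equiv e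
  have h2 : (Fintype.card X : ℝ) - 1 ≠ 0 := by linarith
  have h3 : (Fintype.card X : ℝ) ≠ 0 := by linarith
  have e1 : ∀ y, outputProb (partialErasure η x₀) stdSimplex.barycenter y *
      ((1 + relChange e x₀ ε z y) * (1 + relChange e x₀ ε z' y)) =
      outputProb (partialErasure η x₀) stdSimplex.barycenter y +
      outputProb (partialErasure η x₀) stdSimplex.barycenter y * relChange e x₀ ε z y +
      outputProb (partialErasure η x₀) stdSimplex.barycenter y * relChange e x₀ ε z' y +
      outputProb (partialErasure η x₀) stdSimplex.barycenter y *
        (relChange e x₀ ε z y * relChange e x₀ ε z' y) := fun y => by ring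
  -- The terms linear in `relChange` vanish, leaving the correlation.
  simp only [e1, Finset.sum_add_distrib, sum_outputProb,
    sum_outputProb_mul_relChange e η x₀ hε hε2, add_zero]
  congr 1
  rw [Fintype.sum_option, outputProb_partialErasure_none]
  -- Every symbol carries weight `η`, with an excess `1 - η` at `x₀`. Both members of a pair have
  -- the same sign product, hence `2 * η`; the erasure message adds the term with `(card X - 1)⁻¹`.
  have e2 : ∀ x, outputProb (partialErasure η x₀) stdSimplex.barycenter (some x) *
      (relChange e x₀ ε z (some x) * relChange e x₀ ε z' (some x)) =
      4 * ε ^ 2 * (Fintype.card X : ℝ)⁻¹ * η * (pairSign e z x * pairSign e z' x) +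
      (if x = x₀ then 4 * ε ^ 2 * (Fintype.card X : ℝ)⁻¹ * (1 - η) *
        (pairSign e z x * pairSign e z' x) else 0) := fun x => by
    rw [outputProb_partialErasure_some, coe_barycenter]
    simp only [relChange]
    split_ifs <;> ring
  have e3 : ∀ i, 4 * ε ^ 2 * (Fintype.card X : ℝ)⁻¹ * (2 * η +
      (1 - η) * (((Fintype.card X : ℝ) - 1)⁻¹ + 1) * if (e x₀).2 = i then 1 else 0) *
        (boolSign (z i) * boolSign (z' i)) =
      4 * ε ^ 2 * (Fintype.card X : ℝ)⁻¹ * (2 * η) * (boolSign (z i) * boolSign (z' i)) +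
      (if (e x₀).2 = i then 4 * ε ^ 2 * (Fintype.card X : ℝ)⁻¹ * ((1 - η) *
        (((Fintype.card X : ℝ) - 1)⁻¹ + 1)) * (boolSign (z i) * boolSign (z' i)) else 0) :=
    fun i => by split_ifs <;> ring
  simp only [e2, e3, Finset.sum_add_distrib, Finset.sum_ite_eq, Finset.sum_ite_eq',
    Finset.mem_univ, if_true, ← Finset.mul_sum, sum_pairSign_mul_pairSign]
  rw [coe_barycenter, ← pairSign_mul_pairSign e]
  simp only [relChange]
  field_simp
  ring

/-- The second moment of the average likelihood ratio of the messages. -/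
lemma sum_messagesProb_mul_likelihood_le (hε : 0 ≤ ε) (hε2 : ε ≤ 1 / 2) {n : ℕ}
    (x : Fin n → X) :
    ∑ z : I → Bool, ∑ z' : I → Bool, ∑ y,
      messagesProb (fun t => partialErasure η (x t)) stdSimplex.barycenter y *
        ((∏ t, (1 + relChange e (x t) ε z (y t))) * ∏ t, (1 + relChange e (x t) ε z' (y t))) ≤
      (Fintype.card (I → Bool) : ℝ) ^ 2 * Real.exp ((∑ i, (∑ t,
        4 * ε ^ 2 * (Fintype.card X : ℝ)⁻¹ * (2 * η + (1 - η) *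
          (((Fintype.card X : ℝ) - 1)⁻¹ + 1) * if (e (x t)).2 = i then 1 else 0)) ^ 2) / 2) := by
  set c : I → ℝ := fun i => ∑ t, 4 * ε ^ 2 * (Fintype.card X : ℝ)⁻¹ * (2 * η + (1 - η) *
    (((Fintype.card X : ℝ) - 1)⁻¹ + 1) * if (e (x t)).2 = i then 1 else 0) with hc
  have h : ∀ z z' : I → Bool, ∑ y,
      messagesProb (fun t => partialErasure η (x t)) stdSimplex.barycenter y *
        ((∏ t, (1 + relChange e (x t) ε z (y t))) * ∏ t, (1 + relChange e (x t) ε z' (y t))) ≤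
      Real.exp (∑ i, c i * (boolSign (z i) * boolSign (z' i))) := by
    intro z z'
    simp only [messagesProb, ← Finset.prod_mul_distrib]
    rw [← Fintype.prod_sum fun t y => outputProb (partialErasure η (x t)) stdSimplex.barycenter y *
      ((1 + relChange e (x t) ε z y) * (1 + relChange e (x t) ε z' y))]
    simp only [hc, Finset.sum_mul]
    -- The inequality `1 + x ≤ exp x`, applied user by user, makes the exponent linear in the sign
    -- products, so for fixed `z` the Rademacher bound applies to the sum over `z'`.
    rw [Finset.sum_comm, Real.exp_sum]
    refine Finset.prod_le_prod (fun t _ => Finset.sum_nonneg fun y _ => mul_nonneg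
      (outputProb_nonneg _ _ y) (mul_nonneg (one_add_relChange_nonneg e (x t) hε hε2 z y)
        (one_add_relChange_nonneg e (x t) hε hε2 z' y))) fun t _ => ?_
    rw [sum_outputProb_mul_likelihood e η (x t) hε hε2, add_comm]
    exact Real.add_one_le_exp _
  refine (Finset.sum_le_sum fun z _ => (Finset.sum_le_sum fun z' _ => h z z').trans
    (sum_exp_sum_boolSign_le c z)).trans_eq ?_
  rw [Finset.sum_const, Finset.card_univ, nsmul_eq_mul, sq, mul_assoc]

/-- The number of users whose pair is `i` enters the exponent only through its square, whose sum
over `i` is at most `n ^ 2`. -/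
lemma sum_sq_sum_le {n : ℕ} (j : Fin n → I) {A η α : ℝ} (hα0 : 0 ≤ α) (hα : α ≤ 2)
    (hη : Fintype.card I * η ^ 2 = 1) :
    ∑ i, (∑ t, A * (2 * η + α * if j t = i then 1 else 0)) ^ 2 ≤ 16 * A ^ 2 * (n : ℝ) ^ 2 := by
  set N : I → ℝ := fun i => ∑ t, if j t = i then 1 else 0 with hN
  have hN0 : ∀ i, 0 ≤ N i := fun i => Finset.sum_nonneg fun t _ => by split_ifs <;> norm_num
  have hNs : ∑ i, N i = n := by
    rw [hN, Finset.sum_comm]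
    simp
  have hN2 : ∑ i, N i ^ 2 ≤ (n : ℝ) ^ 2 := by
    rw [← hNs]
    exact Finset.sum_sq_le_sq_sum_of_nonneg fun i _ => hN0 i
  -- This is `(a + b)² ≤ 2a² + 2b²` with `α ≤ 2`. After summing over `i`, both halves are at most
  -- `8A²n²`, the first because `card I * η² = 1`.
  have h : ∀ i, (∑ t, A * (2 * η + α * if j t = i then 1 else 0)) ^ 2 ≤
      8 * A ^ 2 * n ^ 2 * η ^ 2 + 8 * A ^ 2 * N i ^ 2 := by
    intro i
    have e1 : ∑ t, A * (2 * η + α * if j t = i then 1 else 0) = A * (2 * n * η + α * N i) := by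
      rw [← Finset.mul_sum, Finset.sum_add_distrib, ← Finset.mul_sum _ _ α, Finset.sum_const,
        Finset.card_univ, Fintype.card_fin, nsmul_eq_mul]
      ring
    have h2 : (α * N i) ^ 2 ≤ (2 * N i) ^ 2 :=
      pow_le_pow_left₀ (mul_nonneg hα0 (hN0 i)) (mul_le_mul_of_nonneg_right hα (hN0 i)) 2
    have h3 : (2 * n * η + α * N i) ^ 2 ≤ 8 * n ^ 2 * η ^ 2 + 8 * N i ^ 2 := by
      nlinarith [sq_nonneg (2 * n * η - α * N i)]
    rw [e1, mul_pow]
    nlinarith [mul_le_mul_of_nonneg_left h3 (sq_nonneg A)]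
  refine (Finset.sum_le_sum fun i _ => h i).trans ?_
  rw [Finset.sum_add_distrib, Finset.sum_const, ← Finset.mul_sum, nsmul_eq_mul, Finset.card_univ]
  have e2 : Fintype.card I * (8 * A ^ 2 * n ^ 2 * η ^ 2) = 8 * A ^ 2 * (n : ℝ) ^ 2 := by
    linear_combination 8 * A ^ 2 * (n : ℝ) ^ 2 * hη
  rw [e2]
  linarith [mul_le_mul_of_nonneg_left hN2 (sq_nonneg A)]

end PairedPerturbation

/-! ### The lower bound on the number of users. -/

lemma exp_half_le_two : Real.exp (1 / 2) ≤ 2 := by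
  have h := Real.add_one_le_exp (-(1 / 2) : ℝ)
  have h2 : Real.exp (1 / 2) * Real.exp (-(1 / 2)) = 1 := by rw [← Real.exp_add]; simp
  nlinarith [Real.exp_pos (1 / 2 : ℝ)]

theorem le_of_mem_publicCoinTestSizes (k : ℕ) [NeZero k] {ε : ℝ} (hε : 0 < ε) (hε2 : ε ≤ 1 / 2)
    {n : ℕ} (hn : n ∈ publicCoinTestSizes (partialErasureFamily (Fin (2 * k)) (invSqrt k)) ε) :
    1 / 10 * (k / ε ^ 2) ≤ n := by
  by_contra! hlt
  obtain ⟨P, T, h0, h1⟩ := hn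
  have hk : (1 : ℝ) ≤ k := by exact_mod_cast NeZero.one_le
  have hk0 : (0 : ℝ) < k := by linarith
  let e : Fin (2 * k) ≃ Bool × Fin k := finProdFinEquiv.symm.trans
    (finTwoEquiv.prodCongr (Equiv.refl _))
  have hsum := sum_decisionProb_le P T stdSimplex.barycenter (pairPerturbed e hε.le hε2) (M := 2)
    fun u => by
      -- For fixed coins, each user's channel is determined by its exactly transmitted symbol.
      choose x hx using fun t => P.chan_mem t u
      refine ⟨fun z y => ∏ t, (1 + relChange e (x t) ε z (y t)), fun z y => ?_, ?_⟩
      · simp only [messagesProb, ← hx, outputProb_pairPerturbed, Finset.prod_mul_distrib]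
      · simp only [← hx]
        refine (sum_messagesProb_mul_likelihood_le e (invSqrt k) hε.le hε2 x).trans
          (mul_le_mul_of_nonneg_left (le_trans (Real.exp_le_exp.mpr ?_) exp_half_le_two)
            (sq_nonneg _))
        have hη0 : 0 ≤ (invSqrt k : ℝ) := (invSqrt k).2.1
        have hη1 : (invSqrt k : ℝ) ≤ 1 := (invSqrt k).2.2
        have hinv : ((Fintype.card (Fin (2 * k)) : ℝ) - 1)⁻¹ ≤ 1 := by
          refine inv_le_one_of_one_le₀ ?_
          simp
          linarith
        have hinv0 : 0 ≤ ((Fintype.card (Fin (2 * k)) : ℝ) - 1)⁻¹ := by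
          simp
          linarith
        have hs := sum_sq_sum_le (fun t => (e (x t)).2)
          (A := 4 * ε ^ 2 * (Fintype.card (Fin (2 * k)) : ℝ)⁻¹) (η := invSqrt k)
          (α := (1 - invSqrt k) * (((Fintype.card (Fin (2 * k)) : ℝ) - 1)⁻¹ + 1))
          (mul_nonneg (by linarith) (by linarith)) (by nlinarith)
          (by rw [invSqrt_sq (NeZero.ne k), Fintype.card_fin]; field_simp)
        -- The left side is `2nε²/k`, below 1/5 by the assumption on `n`; then `16/25 ≤ 1` bounds
        -- the exponent by 1/2.
        have hA : 4 * ε ^ 2 * (Fintype.card (Fin (2 * k)) : ℝ)⁻¹ * n ≤ 1 / 5 := by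
          have : (n : ℝ) * ε ^ 2 ≤ k / 10 := by
            have := mul_le_mul_of_nonneg_right hlt.le (sq_nonneg ε)
            have e : 1 / 10 * (k / ε ^ 2) * ε ^ 2 = k / 10 := by field_simp
            rwa [e] at this
          have e' : 4 * ε ^ 2 * (Fintype.card (Fin (2 * k)) : ℝ)⁻¹ * n = 2 * (n * ε ^ 2) / k := by
            simp
            field_simp
            norm_num
          rw [e', div_le_iff₀ hk0]
          linarith
        have hA2 := pow_le_pow_left₀ (by positivity) hA 2
        rw [div_le_div_iff_of_pos_right two_pos]
        refine hs.trans ?_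
        rw [mul_pow] at hA2
        linarith
  have hlow : (Fintype.card (Fin k → Bool) : ℝ) * (99 / 100) ≤
      ∑ z, decisionProb P T (pairPerturbed e hε.le hε2 z) 1 := by
    rw [← nsmul_eq_mul, ← Finset.card_univ]
    exact Finset.card_nsmul_le_sum _ _ _ fun z _ => h1 _ (le_tvDist_pairPerturbed e hε.le hε2 z)
  -- The average power is at least 99/100, yet at most `10/100 + 2/40` since the false alarm
  -- probability is at most 1/100.
  have := le_of_mul_le_mul_left (hlow.trans hsum) (by exact_mod_cast Fintype.card_pos)
  have := decisionProb_zero_add_one P T stdSimplex.barycenter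
  linarith

/-! ### Comparison of the two models and existence of the sample complexities. -/

lemma mem_publicCoinTestSizes_of_private {X Y : Type} [Fintype X] [Fintype Y] [Nonempty X]
    {𝒲 : Set (Channel X Y)} {ε : ℝ} {n : ℕ} (h : n ∈ privateCoinTestSizes 𝒲 ε) :
    n ∈ publicCoinTestSizes 𝒲 ε :=
  let ⟨Q, T, hT⟩ := h
  ⟨Q.toPublic, Decision.ofMessages Q.toPublic T, hT⟩

lemma exists_mem_privateCoinTestSizes_le (k : ℕ) [NeZero k] {ε : ℝ} (hε : 0 < ε) (hε1 : ε ≤ 1) :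
    ∃ n ∈ privateCoinTestSizes (partialErasureFamily (Fin (2 * k)) (invSqrt k)) ε,
      (n : ℝ) ≤ 8002 * (k / ε ^ 2) := by
  have hk : (1 : ℝ) ≤ k := by exact_mod_cast NeZero.one_le
  -- Rounding up both halves costs at most 2 users, which this absorbs: `8002 = 2 * 4000 + 2`.
  have h1 : 1 ≤ k / ε ^ 2 := by
    rw [le_div_iff₀ (by positivity)]
    have := pow_le_one₀ hε.le hε1 (n := 2)
    linarith
  refine ⟨_, add_self_mem_privateCoinTestSizes k hε hε1 (Nat.le_ceil _), ?_⟩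
  have := Nat.ceil_lt_add_one (a := 4000 * (k / ε ^ 2)) (by positivity)
  push_cast
  linarith

end DistributedTesting

end

open DistributedTesting
theorem propositiont :
    ∃ c C : ℝ, 0 < c ∧ 0 < C ∧ ∀ (k : ℕ) [NeZero k] (ε : ℝ), 0 < ε → ε ≤ 1 →
      ∃ nPub nPriv : ℕ,
        IsPublicCoinSampleComplexity
          (partialErasureFamily (Fin (2 * k)) (invSqrt k)) ε nPub ∧
        IsPrivateCoinSampleComplexity
          (partialErasureFamily (Fin (2 * k)) (invSqrt k)) ε nPriv ∧
        (nPub : ℝ) ≤ C * (k / ε ^ 2) ∧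
        (nPriv : ℝ) ≤ C * (k / ε ^ 2) ∧
        (ε ≤ 1 / 2 → c * (k / ε ^ 2) ≤ nPub ∧ c * (k / ε ^ 2) ≤ nPriv) := by
  refine ⟨1 / 10, 8002, by norm_num, by norm_num, fun k _ ε hε hε1 => ?_⟩
  obtain ⟨n, hn, hle⟩ := exists_mem_privateCoinTestSizes_le k hε hε1
  have hn' := mem_publicCoinTestSizes_of_private hn
  -- Both sets of sizes are nonempty, so their infima are least elements; the private lower bound
  -- follows from the public one by inclusion.
  refine ⟨sInf _, sInf _, ⟨Nat.sInf_mem ⟨n, hn'⟩, fun m hm => Nat.sInf_le hm⟩,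
    ⟨Nat.sInf_mem ⟨n, hn⟩, fun m hm => Nat.sInf_le hm⟩,
    le_trans (by exact_mod_cast Nat.sInf_le hn') hle,
    le_trans (by exact_mod_cast Nat.sInf_le hn) hle, fun hε2 =>
    ⟨le_of_mem_publicCoinTestSizes k hε hε2 (Nat.sInf_mem ⟨n, hn'⟩),
      le_of_mem_publicCoinTestSizes k hε hε2
        (mem_publicCoinTestSizes_of_private (Nat.sInf_mem ⟨n, hn⟩))⟩⟩
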